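/- For a finite group $G$ let $\pi(G)$ be the set of primes dividing $|G|$. The prime graph complement $\overline{\Gamma}(G)$ is the labelled graph with vertex set $\pi(G)$ in which two distinct primes $r,s$ are joined by an edge $r-s$ if and only if $G$ has no element of order $rs$. Let $T$ be a finite simple group and let $p\in\pi(T)$. Fix a maximal ideal $M$ containing $p$ of the ring $R$ of all algebraic integers in $\mathbb{C}$, and let $F=R/M$ (an algebraic closure of $\mathbb{F}_p$). The Brauer character of a representation $\rho:T\to\mathrm{GL}(n,F)$ is the function $\chi$ on the elements of $T$ of order prime to $p$ given by $\chi(g)=\xi_1+\dots+\xi_n$, where $\xi_1,\dots,\xi_n\in R$ are the roots of unity of order prime to $p$ whose reductions modulo $M$ are the eigenvalues of $\rho(g)$, counted with multiplicity. Let $\operatorname{IBr}_p(T)$ be the set of Brauer characters of the irreducible representations of $T$ over $F$. For $\chi\in\operatorname{IBr}_p(T)$ let $A_\chi$ be the set of all edges $p-q$, with $q\neq p$ a prime, such that there is a $g\in T$ of order $o(g)=q$ with $$\frac{1}{o(g)}\sum_{x\in\langle g\rangle}\chi(x)>0 .$$ Then, for every labelled graph $\Lambda$, the following are equivalent: (i)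 $\Lambda=\overline{\Gamma}(G)$ for some finite group $G$ of the form $N.T$ with $N$ a $p$-group, that is, some finite group $G$ with a normal $p$-subgroup $N$ such that $G/N\cong T$; (ii) there is a subset $Y\subseteq\operatorname{IBr}_p(T)$ such that $\Lambda=\overline{\Gamma}(T)\setminus\bigcup_{\chi\in Y}A_\chi$, that is, $\Lambda$ is obtained from $\overline{\Gamma}(T)$ by keeping all vertices and deleting every edge that lies in $\bigcup_{\chi\in Y}A_\chi$. -/

import Mathlib

noncomputable section

open scoped ComplexOrder

namespace PrimeGraphExtension

/-! ### Labelled graphs and prime graphs -/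

/-- A graph whose vertices are labelled by natural numbers: a set of vertices together with
an irreflexive symmetric adjacency relation on it. Equality is equality of labelled graphs. -/
abbrev LabeledGraph : Type := (⊤ : SimpleGraph ℕ).Subgraph

/-- The complement of a labelled graph: the same vertices, and two distinct vertices are adjacent
exactly when they were not. -/
def complement (Γ : LabeledGraph) : LabeledGraph where
  verts := Γ.verts
  Adj a b := a ∈ Γ.verts ∧ b ∈ Γ.verts ∧ a ≠ b ∧ ¬ Γ.Adj a b
  adj_sub h := h.2.2.1
  edge_vert h := h.1
  symm := ⟨fun _ _ h => ⟨h.2.1, h.1, h.2.2.1.symm, fun h' => h.2.2.2 h'.symm⟩⟩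

/-- The set of prime divisors of the order of a finite group. -/
def primeDivisors (G : Type*) : Set ℕ := {p | p.Prime ∧ p ∣ Nat.card G}

/-- The prime graph (Gruenberg--Kegel graph) of a finite group `G`: the vertices are the prime
divisors of `|G|`, and distinct `p`, `q` are adjacent if `G` has an element of order `p * q`. -/
def primeGraph (G : Type*) [Group G] : LabeledGraph where
  verts := primeDivisors G
  Adj a b := a ∈ primeDivisors G ∧ b ∈ primeDivisors G ∧ a ≠ b ∧ ∃ g : G, orderOf g = a * b
  adj_sub h := h.2.2.1
  edge_vert h := h.1
  symm := ⟨fun a b h => ⟨h.2.1, h.1, h.2.2.1.symm, by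
    obtain ⟨g, hg⟩ := h.2.2.2
    exact ⟨g, hg.trans (mul_comm a b)⟩⟩⟩

/-- The prime graph complement of a finite group. -/
def primeGraphComplement (G : Type*) [Group G] : LabeledGraph := complement (primeGraph G)

/-- `Λ` is the prime graph complement of some finite group `G` of the form `N.T` with `N` a
`p`-group. -/
def IsRealizableByPGroupExtension.{u} (p : ℕ) (T : Type u) [Group T] (Λ : LabeledGraph) : Prop :=
  ∃ (G : Type u) (_ : Group G) (_ : Finite G) (N : Subgroup G) (_ : N.Normal),
    IsPGroup p N ∧ Nonempty (G ⧸ N ≃* T) ∧ Λ = primeGraphComplement G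

/-! ### Brauer characters -/

/-- The ring of all algebraic integers in `ℂ`. -/
abbrev AlgebraicIntegers : Subalgebra ℤ ℂ := integralClosure ℤ ℂ

/-- The residue field of the ring of algebraic integers at a maximal ideal. If the ideal lies
above the prime `p`, this is an algebraic closure of the field with `p` elements. -/
def ResidueField (M : Ideal AlgebraicIntegers) : Type := AlgebraicIntegers ⧸ M

instance (M : Ideal AlgebraicIntegers) [M.IsMaximal] : Field (ResidueField M) :=
  Ideal.Quotient.field M

/-- The reduction of algebraic integers modulo the maximal ideal `M`. -/
def reduction (M : Ideal AlgebraicIntegers) [M.IsMaximal] : AlgebraicIntegers →+* ResidueField M :=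
  Ideal.Quotient.mk M

/-- The `p`-regular elements of `T`: those of order prime to `p`. -/
def PRegular (p : ℕ) (T : Type*) [Group T] : Type _ := {g : T // (orderOf g).Coprime p}

/-- Elements of the cyclic group generated by a `p`-regular element are `p`-regular. -/
def PRegular.ofMemZPowers {p : ℕ} {T : Type*} [Group T] (g : PRegular p T)
    (x : Subgroup.zpowers g.1) : PRegular p T :=
  ⟨x.1, Nat.Coprime.coprime_dvd_left (orderOf_dvd_of_mem_zpowers x.2) g.2⟩

/-- `χ` is the Brauer character mod `p` (with respect to `M`) of the representation `ρ` over the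
residue field of `M`: for every `p`-regular `g`, if the eigenvalues of `ρ g`, with multiplicity,
are the reductions of the complex roots of unity `ξ₁, …, ξₙ` of order prime to `p`,
then `χ g = ξ₁ + ⋯ + ξₙ`. -/
def IsBrauerCharacter (p : ℕ) (M : Ideal AlgebraicIntegers) [M.IsMaximal] {T : Type*} [Group T]
    {n : ℕ} (ρ : Representation (ResidueField M) T (Fin n → ResidueField M))
    (χ : PRegular p T → ℂ) : Prop :=
  ∀ g : PRegular p T, ∃ ξ : Multiset AlgebraicIntegers,
    (∀ z ∈ ξ, ∃ m : ℕ, m.Coprime p ∧ z ^ m = 1) ∧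
    (ρ g.1).charpoly = (ξ.map fun z => Polynomial.X - Polynomial.C (reduction M z)).prod ∧
    χ g = (ξ.map fun z => (z : ℂ)).sum

/-- The set of irreducible Brauer characters of `T` mod `p` (with respect to `M`). -/
def IBr (p : ℕ) (M : Ideal AlgebraicIntegers) [M.IsMaximal] (T : Type*) [Group T] :
    Set (PRegular p T → ℂ) :=
  {χ | ∃ (n : ℕ) (ρ : Representation (ResidueField M) T (Fin n → ResidueField M)),
    ρ.IsIrreducible ∧ IsBrauerCharacter p M ρ χ}

/-- The average of `χ` over the cyclic subgroup generated by the `p`-regular element `g`. -/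
def cyclicAverage {p : ℕ} {T : Type*} [Group T] (χ : PRegular p T → ℂ) (g : PRegular p T) : ℂ :=
  (1 / (orderOf g.1 : ℂ)) * ∑ᶠ x : Subgroup.zpowers g.1, χ (g.ofMemZPowers x)

/-- The set of edges `p - q`, with `q ≠ p` prime, for which some `g` of order `q` has a positive
average of `χ` over the cyclic subgroup it generates. Positivity of a complex number includes
that it is real. An element of prime order is `p`-regular exactly if its order is not `p`. -/
def fixedPointEdges (p : ℕ) {T : Type*} [Group T] (χ : PRegular p T → ℂ) : Set (Sym2 ℕ) :=
  {e | ∃ q : ℕ, q.Prime ∧ q ≠ p ∧ e = s(p, q) ∧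
    ∃ g : PRegular p T, orderOf g.1 = q ∧ 0 < cyclicAverage χ g}

end PrimeGraphExtension

end

open PrimeGraphExtension

/-!
For a prime `q ≠ p`, an extension `G = N.T` by a `p`-group `N` loses the edge `p - q` exactly when
some element of order `q` in `T` has a preimage in `G` centralizing a nontrivial element of `N`.
Whether this happens can be read off layer by layer from a series of normal subgroups of `G` inside
`N`. Taking successively the subgroups `Ω₁(Z(N))`, on which `N` acts trivially, turns it into the
existence of an eigenvalue `1` on a finite `𝔽_p T`-module, hence on one of the irreducible
constituents of its scalar extension to the residue field. Conversely, given irreducible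
representations over the residue field, finitely many fixed vectors in their direct sum generate a
finite `𝔽_p T`-module, and its semidirect product with `T` loses exactly the prescribed edges.

The eigenvalues of a `p`-regular `g` lift uniquely to roots of unity `ξ` in `ℂ`. Summing the powers
of `ξ` over the exponents of `⟨g⟩` gives `0` unless `ξ = 1`, so the average of a Brauer character
over `⟨g⟩` is the multiplicity of `1` as an eigenvalue of `g`.
-/

noncomputable section

namespace PrimeGraphExtension

open scoped ComplexOrder
open Module.End (HasEigenvalue)

/-! ### Eigenvalues -/

section Eigenvalues

theorem hasEigenvalue_iff_exists_ne_zero {R V : Type*} [CommRing R] [AddCommGroup V] [Module R V]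
    {f : Module.End R V} {μ : R} : HasEigenvalue f μ ↔ ∃ v ≠ 0, f v = μ • v := by
  simp only [Module.End.hasEigenvalue_iff, Submodule.ne_bot_iff, Module.End.mem_eigenspace_iff,
    and_comm]

theorem hasEigenvalue_of_injective {R V W : Type*} [CommRing R] [AddCommGroup V] [Module R V]
    [AddCommGroup W] [Module R W] {f : Module.End R V} {g : Module.End R W} (e : V →ₗ[R] W)
    (he : Function.Injective e) (hfg : e ∘ₗ f = g ∘ₗ e) {μ : R} (hμ : HasEigenvalue f μ) :
    HasEigenvalue g μ := by
  obtain ⟨v, hv, hfv⟩ := hasEigenvalue_iff_exists_ne_zero.1 hμ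
  refine hasEigenvalue_iff_exists_ne_zero.2 ⟨e v, (map_ne_zero_iff e he).2 hv, ?_⟩
  rw [← LinearMap.comp_apply, ← hfg, LinearMap.comp_apply, hfv, map_smul]

theorem hasEigenvalue_conj_iff {R V W : Type*} [CommRing R] [AddCommGroup V] [Module R V]
    [AddCommGroup W] [Module R W] (e : V ≃ₗ[R] W) {f : Module.End R V} {μ : R} :
    HasEigenvalue (e.conj f) μ ↔ HasEigenvalue f μ := by
  refine ⟨hasEigenvalue_of_injective e.symm.toLinearMap e.symm.injective ?_,
    hasEigenvalue_of_injective e.toLinearMap e.injective ?_⟩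
  all_goals
    ext v
    simp [LinearEquiv.conj_apply]

variable {k V : Type*} [Field k] [AddCommGroup V] [Module k V]

theorem hasEigenvalue_iff_det_eq_zero [FiniteDimensional k V] {f : Module.End k V} {μ : k} :
    HasEigenvalue f μ ↔ LinearMap.det (algebraMap k (Module.End k V) μ - f) = 0 := by
  rw [Module.End.hasEigenvalue_iff_isRoot_charpoly, Polynomial.IsRoot.def,
    LinearMap.eval_charpoly]

theorem hasEigenvalue_iff_restrict_or_mapQ [FiniteDimensional k V] {f : Module.End k V}
    {W : Submodule k V} (hW : W ≤ W.comap f) {μ : k} :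
    HasEigenvalue f μ ↔ HasEigenvalue (f.restrict hW) μ ∨ HasEigenvalue (W.mapQ W f hW) μ := by
  have hW' : W ≤ W.comap (algebraMap k (Module.End k V) μ - f) := fun v hv =>
    W.sub_mem (W.smul_mem μ hv) (hW hv)
  simp only [hasEigenvalue_iff_det_eq_zero]
  rw [LinearMap.det_eq_det_mul_det W _ hW', mul_eq_zero]
  refine or_congr (iff_of_eq ?_) (iff_of_eq ?_)
  · rfl
  · congr 2
    ext v
    simp

theorem hasEigenvalue_baseChange_iff [FiniteDimensional k V] (K : Type*) [Field K] [Algebra k K]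
    {f : Module.End k V} {μ : k} :
    HasEigenvalue (f.baseChange K) (algebraMap k K μ) ↔ HasEigenvalue f μ := by
  rw [Module.End.hasEigenvalue_iff_isRoot_charpoly, Module.End.hasEigenvalue_iff_isRoot_charpoly,
    LinearMap.charpoly_baseChange, Polynomial.isRoot_map_iff (algebraMap k K).injective]

end Eigenvalues

/-! ### Irreducible constituents -/

section Constituents

variable {k G V : Type*} [Field k] [Monoid G] [AddCommGroup V] [Module k V]

theorem exists_representation_fin_hasEigenvalue_iff [FiniteDimensional k V]
    (τ : Representation k G V) :
    ∃ ρ : Representation k G (Fin (Module.finrank k V) → k),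
      ∀ g μ, HasEigenvalue (ρ g) μ ↔ HasEigenvalue (τ g) μ := by
  let e : V ≃ₗ[k] (Fin (Module.finrank k V) → k) := (Module.finBasis k V).equivFun
  exact ⟨(e.conjRingEquiv : Module.End k V →* _).comp τ, fun g _ =>
    hasEigenvalue_conj_iff e (f := τ g)⟩

theorem exists_proper_subrepresentation [Nontrivial V] {ρ : Representation k G V}
    (hρ : ¬ ρ.IsIrreducible) :
    ∃ W : Subrepresentation ρ, W.toSubmodule ≠ ⊥ ∧ W.toSubmodule ≠ ⊤ := by
  by_contra! h
  have : Nontrivial (Subrepresentation ρ) :=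
    ⟨⊥, ⊤, fun h => bot_ne_top (α := Submodule k V) (congrArg Subrepresentation.toSubmodule h)⟩
  refine hρ { eq_bot_or_eq_top := fun W => or_iff_not_imp_left.2 fun hW => ?_ }
  exact Subrepresentation.toSubmodule_injective
    (h W fun hbot => hW (Subrepresentation.toSubmodule_injective hbot))

theorem exists_isIrreducible_hasEigenvalue_fin {n : ℕ} (τ : Representation k G (Fin n → k))
    {g : G} {μ : k} (hg : HasEigenvalue (τ g) μ) :
    ∃ (m : ℕ) (ρ : Representation k G (Fin m → k)), ρ.IsIrreducible ∧ HasEigenvalue (ρ g) μ ∧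
      ∀ h ν, HasEigenvalue (ρ h) ν → HasEigenvalue (τ h) ν := by
  induction n using Nat.strong_induction_on with | _ n ih
  by_cases hτ : τ.IsIrreducible
  · exact ⟨n, τ, hτ, hg, fun _ _ => id⟩
  obtain ⟨v, hv, -⟩ := hasEigenvalue_iff_exists_ne_zero.1 hg
  have : Nontrivial (Fin n → k) := ⟨v, 0, hv⟩
  obtain ⟨W, hbot, htop⟩ := exists_proper_subrepresentation hτ
  have hW (h : G) : W.toSubmodule ≤ W.toSubmodule.comap (τ h) := W.apply_mem_toSubmodule h
  have hdim := W.toSubmodule.finrank_quotient_add_finrank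
  rw [Module.finrank_fin_fun] at hdim
  rcases (hasEigenvalue_iff_restrict_or_mapQ (hW g)).1 hg with hsub | hquot
  · obtain ⟨σ, hσ⟩ := exists_representation_fin_hasEigenvalue_iff
      (τ.subrepresentation W.toSubmodule hW)
    have hlt := Submodule.finrank_lt htop
    rw [Module.finrank_fin_fun] at hlt
    obtain ⟨m, ρ, hρ, hρg, hρσ⟩ := ih _ hlt σ ((hσ g μ).2 hsub)
    exact ⟨m, ρ, hρ, hρg, fun h ν hν => (hasEigenvalue_iff_restrict_or_mapQ (hW h)).2
      (.inl ((hσ h ν).1 (hρσ h ν hν)))⟩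
  · obtain ⟨σ, hσ⟩ := exists_representation_fin_hasEigenvalue_iff
      (τ.quotient W.toSubmodule hW)
    have hpos := Submodule.one_le_finrank_iff.2 hbot
    obtain ⟨m, ρ, hρ, hρg, hρσ⟩ := ih _ (by omega) σ ((hσ g μ).2 hquot)
    exact ⟨m, ρ, hρ, hρg, fun h ν hν => (hasEigenvalue_iff_restrict_or_mapQ (hW h)).2
      (.inr ((hσ h ν).1 (hρσ h ν hν)))⟩

theorem exists_isIrreducible_hasEigenvalue [FiniteDimensional k V] (K : Type*) [Field K]
    [Algebra k K] (τ : Representation k G V) {g : G} {μ : k} (hg : HasEigenvalue (τ g) μ) :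
    ∃ (n : ℕ) (ρ : Representation K G (Fin n → K)), ρ.IsIrreducible ∧
      HasEigenvalue (ρ g) (algebraMap k K μ) ∧
      ∀ h ν, HasEigenvalue (ρ h) (algebraMap k K ν) → HasEigenvalue (τ h) ν := by
  let τK : Representation K G (TensorProduct k K V) :=
    (Module.End.baseChangeHom k K V : Module.End k V →* _).comp τ
  have hτK (h : G) (ν : k) : HasEigenvalue (τK h) (algebraMap k K ν) ↔ HasEigenvalue (τ h) ν :=
    hasEigenvalue_baseChange_iff K
  obtain ⟨σ, hσ⟩ := exists_representation_fin_hasEigenvalue_iff τK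
  obtain ⟨n, ρ, hρ, hρg, hρσ⟩ :=
    exists_isIrreducible_hasEigenvalue_fin σ ((hσ g _).2 ((hτK g μ).2 hg))
  exact ⟨n, ρ, hρ, hρg, fun h ν hν => (hτK h ν).1 ((hσ h _).1 (hρσ h _ hν))⟩

end Constituents

/-! ### Lifting roots of unity -/

section RootsOfUnity

variable {R S : Type*} [CommRing R] [IsDomain R] [CommRing S] {m l : ℕ}

theorem sum_range_pow_of_pow_eq_one [DecidableEq R] {z : R} (hz : z ^ m = 1) :
    ∑ i ∈ Finset.range m, z ^ i = if z = 1 then (m : R) else 0 := by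
  split_ifs with h
  · simp [h]
  · have hgeom := mul_geom_sum z m
    rw [hz, sub_self] at hgeom
    exact (mul_eq_zero.1 hgeom).resolve_left (sub_ne_zero.2 h)

theorem sum_range_sum_map_pow [DecidableEq R] {ξ : Multiset R} (hξ : ∀ z ∈ ξ, z ^ m = 1) :
    ∑ i ∈ Finset.range m, (ξ.map (· ^ i)).sum = m * ξ.count 1 := by
  rw [← Multiset.sum_map_sum,
    Multiset.map_congr rfl fun z hz => sum_range_pow_of_pow_eq_one (hξ z hz),
    Finset.sum_multiset_map_count]
  by_cases h1 : 1 ∈ ξ <;> simp [h1, mul_comm]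

theorem eq_one_of_map_eq_one_of_pow_eq_one (φ : R →+* S) (hm : (m : S) ≠ 0) {z : R}
    (hz : z ^ m = 1) (h : φ z = 1) : z = 1 := by
  classical
  by_contra h1
  have hsum := congrArg φ (sum_range_pow_of_pow_eq_one hz)
  simp only [if_neg h1, map_sum, map_pow, h, one_pow, Finset.sum_const, Finset.card_range,
    nsmul_eq_mul, mul_one, map_zero] at hsum
  exact hm hsum

variable [IsDomain S]

theorem eq_of_map_eq_of_pow_eq_one (φ : R →+* S) (hm : (m : S) ≠ 0) (hl : (l : S) ≠ 0) {z w : R}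
    (hz : z ^ m = 1) (hw : w ^ l = 1) (h : φ z = φ w) : z = w := by
  have hl0 : l ≠ 0 := by
    rintro rfl
    exact hl Nat.cast_zero
  have hinv : w * w ^ (l - 1) = 1 := by rw [mul_pow_sub_one hl0, hw]
  have hone : z * w ^ (l - 1) = 1 := by
    refine eq_one_of_map_eq_one_of_pow_eq_one φ (m := m * l)
      (by rw [Nat.cast_mul]; exact mul_ne_zero hm hl) ?_ ?_
    · rw [mul_pow, pow_mul, hz, one_pow, one_mul, pow_right_comm, pow_mul', hw, one_pow, one_pow]
    · rw [map_mul, h, ← map_mul, hinv, map_one]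
  calc z = z * w ^ (l - 1) * w := by rw [mul_assoc, mul_comm _ w, hinv, mul_one]
    _ = w := by rw [hone, one_mul]

theorem exists_pow_eq_one_map_eq (φ : R →+* S) {ζ : R} (hζ : IsPrimitiveRoot ζ m)
    (hm : (m : S) ≠ 0) {a : S} (ha : a ^ m = 1) : ∃ z, z ^ m = 1 ∧ φ z = a := by
  have hpow (i : ℕ) : (ζ ^ i) ^ m = 1 := by rw [pow_right_comm, hζ.pow_eq_one, one_pow]
  have hprim : IsPrimitiveRoot (φ ζ) m := by
    refine ⟨by rw [← map_pow, hζ.pow_eq_one, map_one], fun i hi => hζ.dvd_of_pow_eq_one i ?_⟩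
    rw [← map_pow] at hi
    exact eq_one_of_map_eq_one_of_pow_eq_one φ hm (hpow i) hi
  have : NeZero m := ⟨fun h => hm (by rw [h, Nat.cast_zero])⟩
  obtain ⟨i, -, hi⟩ := hprim.eq_pow_of_pow_eq_one ha
  exact ⟨ζ ^ i, hpow i, by rw [map_pow, hi]⟩

end RootsOfUnity

/-! ### Endomorphisms of finite order -/

section FiniteOrder

variable {K V : Type*} [Field K] [AddCommGroup V] [Module K V] [FiniteDimensional K V]

theorem charpoly_eq_prod_of_basis {ι : Type*} [Fintype ι] (b : Module.Basis ι K V) {μ : ι → K}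
    {f : Module.End K V} (hf : ∀ i, f (b i) = μ i • b i) :
    f.charpoly = ∏ i, (Polynomial.X - Polynomial.C (μ i)) := by
  classical
  have hdiag : LinearMap.toMatrix b b f = Matrix.diagonal μ := by
    ext i j
    rw [LinearMap.toMatrix_apply, hf, map_smul, b.repr_self, Finsupp.smul_single, smul_eq_mul,
      mul_one, Finsupp.single_apply, Matrix.diagonal_apply]
    aesop
  rw [← LinearMap.charpoly_toMatrix _ b, hdiag, Matrix.charpoly_diagonal]

theorem exists_basis_apply_eq_smul [IsAlgClosed K] {f : Module.End K V} (hf : f.IsSemisimple) :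
    ∃ (b : Module.Basis (Fin (Module.finrank K V)) K V) (μ : Fin (Module.finrank K V) → K),
      ∀ i, f (b i) = μ i • b i := by
  classical
  let D := DirectSum.isInternal_submodule_of_iSupIndep_of_iSup_eq_top
    f.eigenspaces_iSupIndep hf.iSup_eigenspace_eq_top
  let b := D.collectedBasis fun ν => Module.finBasis K (f.eigenspace ν)
  let e := b.indexEquiv (Module.finBasis K V)
  refine ⟨b.reindex e, fun i => (e.symm i).1, fun i => ?_⟩
  rw [b.reindex_apply]
  exact Module.End.mem_eigenspace_iff.1 (D.collectedBasis_mem _ (e.symm i))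

theorem exists_multiset_charpoly_pow [IsAlgClosed K] {m : ℕ} (hm : (m : K) ≠ 0)
    {f : Module.End K V} (hf : f ^ m = 1) :
    ∃ s : Multiset K, (∀ a ∈ s, a ^ m = 1) ∧ ∀ i : ℕ,
      (f ^ i).charpoly = (s.map fun a => Polynomial.X - Polynomial.C (a ^ i)).prod := by
  have hss : f.IsSemisimple :=
    Module.End.isSemisimple_of_squarefree_aeval_eq_zero (p := Polynomial.X ^ m - Polynomial.C 1)
      (Polynomial.separable_X_pow_sub_C 1 hm one_ne_zero).squarefree (by simp [hf])
  obtain ⟨b, μ, hb⟩ := exists_basis_apply_eq_smul hss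
  have hbpow (i : ℕ) (j) : (f ^ i) (b j) = μ j ^ i • b j := by
    induction i with
    | zero => simp
    | succ i ih => rw [pow_succ', Module.End.mul_apply, ih, map_smul, hb, smul_smul, pow_succ]
  refine ⟨Finset.univ.val.map μ, fun a ha => ?_, fun i => ?_⟩
  · obtain ⟨j, -, rfl⟩ := Multiset.mem_map.1 ha
    refine smul_left_injective K (b.ne_zero j) ?_
    simp only [← hbpow, hf, Module.End.one_apply, one_smul]
  · rw [charpoly_eq_prod_of_basis b (hbpow i), Multiset.map_map]
    rfl

end FiniteOrder

/-! ### Brauer characters -/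

section ResidueField

theorem exists_isRoot_of_monic {A L : Type*} [CommRing A] [Field L] [IsAlgClosed L] [Algebra A L]
    {q : Polynomial (integralClosure A L)} (hq : q.Monic) (hdeg : q.natDegree ≠ 0) :
    ∃ x, q.IsRoot x := by
  obtain ⟨x, hx⟩ := IsAlgClosed.exists_aeval_eq_zero_of_injective L
    (FaithfulSMul.algebraMap_injective (integralClosure A L) L) q
    fun h => hdeg (Polynomial.natDegree_eq_of_degree_eq_some h)
  have hint : IsIntegral A x :=
    isIntegral_trans (A := integralClosure A L) x ⟨q, hq, hx⟩
  refine ⟨⟨x, hint⟩, Subtype.val_injective ?_⟩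
  exact (Polynomial.aeval_algebraMap_apply_eq_algebraMap_eval _ q).symm.trans hx

theorem isAlgClosed_of_surjective {R K : Type*} [CommRing R] [Field K] {φ : R →+* K}
    (hφ : Function.Surjective φ)
    (hR : ∀ q : Polynomial R, q.Monic → q.natDegree ≠ 0 → ∃ x, q.IsRoot x) : IsAlgClosed K := by
  refine IsAlgClosed.of_exists_root _ fun f hf hirr => ?_
  have hlift : f ∈ Polynomial.lifts φ := by
    rw [Polynomial.lifts_iff_coeff_lifts]
    exact fun n => hφ _
  obtain ⟨q, rfl, hdeg, hmonic⟩ := Polynomial.lifts_and_natDegree_eq_and_monic hlift hf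
  obtain ⟨x, hx⟩ := hR q hmonic (hdeg ▸ hirr.natDegree_pos.ne')
  exact ⟨φ x, hx.map⟩

variable {p m : ℕ} {M : Ideal AlgebraicIntegers} [M.IsMaximal]

instance : IsAlgClosed (ResidueField M) :=
  isAlgClosed_of_surjective (φ := reduction M) Ideal.Quotient.mk_surjective
    fun _ => exists_isRoot_of_monic

theorem charP_residueField (hp : p.Prime) (hM : (p : AlgebraicIntegers) ∈ M) :
    CharP (ResidueField M) p := by
  refine (CharP.charP_iff_prime_eq_zero hp).2 ?_
  rw [← map_natCast (reduction M)]
  exact Ideal.Quotient.eq_zero_iff_mem.2 hM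

theorem natCast_ne_zero_of_coprime {K : Type*} [Ring K] [CharP K p] (hp : p.Prime)
    (hm : m.Coprime p) : (m : K) ≠ 0 := by
  rw [Ne, CharP.cast_eq_zero_iff K p]
  exact fun h => hp.one_lt.ne' (Nat.eq_one_of_dvd_coprimes hm h dvd_rfl)

theorem exists_isPrimitiveRoot_algebraicIntegers (hm : m ≠ 0) :
    ∃ ζ : AlgebraicIntegers, IsPrimitiveRoot ζ m := by
  have hζ := Complex.isPrimitiveRoot_exp m hm
  exact ⟨⟨_, hζ.isIntegral (Nat.pos_of_ne_zero hm)⟩, .of_map_of_injective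
    (f := algebraMap AlgebraicIntegers ℂ) hζ Subtype.val_injective⟩

variable [CharP (ResidueField M) p]

theorem exists_eigenvalue_lifts (hp : p.Prime) (hm : m.Coprime p) {V : Type*} [AddCommGroup V]
    [Module (ResidueField M) V] [FiniteDimensional (ResidueField M) V]
    {f : Module.End (ResidueField M) V} (hf : f ^ m = 1) :
    ∃ ξ : Multiset AlgebraicIntegers, (∀ z ∈ ξ, z ^ m = 1) ∧ ∀ i : ℕ, (f ^ i).charpoly =
      (ξ.map fun z => Polynomial.X - Polynomial.C (reduction M (z ^ i))).prod := by
  have hm0 : (m : ResidueField M) ≠ 0 := natCast_ne_zero_of_coprime hp hm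
  obtain ⟨ζ, hζ⟩ := exists_isPrimitiveRoot_algebraicIntegers (m := m) fun h =>
    hm0 (by rw [h, Nat.cast_zero])
  obtain ⟨s, hs, hchar⟩ := exists_multiset_charpoly_pow hm0 hf
  choose! lift hlift hmap using fun a (ha : a ∈ s) =>
    exists_pow_eq_one_map_eq (reduction M) hζ hm0 (hs a ha)
  refine ⟨s.map lift, fun z hz => ?_, fun i => ?_⟩
  · obtain ⟨a, ha, rfl⟩ := Multiset.mem_map.1 hz
    exact hlift a ha
  · rw [hchar, Multiset.map_map]
    refine congrArg Multiset.prod (Multiset.map_congr rfl fun a ha => ?_)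
    rw [Function.comp_apply, map_pow (reduction M), hmap a ha]

theorem map_reduction_injOn (hp : p.Prime) : Set.InjOn (Multiset.map (reduction M))
    {ξ | ∀ z ∈ ξ, ∃ m : ℕ, m.Coprime p ∧ z ^ m = 1} := by
  have hinj : Set.InjOn (reduction M) {z | ∃ m : ℕ, m.Coprime p ∧ z ^ m = 1} := by
    rintro z ⟨m, hm, hz⟩ w ⟨l, hl, hw⟩
    exact eq_of_map_eq_of_pow_eq_one _ (natCast_ne_zero_of_coprime hp hm)
      (natCast_ne_zero_of_coprime hp hl) hz hw
  refine Set.LeftInvOn.injOn (f₁' := Multiset.map (Function.invFunOn (reduction M)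
    {z | ∃ m : ℕ, m.Coprime p ∧ z ^ m = 1})) fun ξ hξ => ?_
  rw [Multiset.map_map]
  exact (Multiset.map_congr rfl fun z hz => hinj.leftInvOn_invFunOn (hξ z hz)).trans
    (Multiset.map_id' ξ)

end ResidueField

section BrauerCharacters

variable {p n : ℕ} {M : Ideal AlgebraicIntegers} [M.IsMaximal] [CharP (ResidueField M) p]
  {T : Type*} [Group T] {ρ : Representation (ResidueField M) T (Fin n → ResidueField M)}
  {χ : PRegular p T → ℂ}

theorem exists_eigenvalue_lifts_of_pRegular (hp : p.Prime)
    (ρ : Representation (ResidueField M) T (Fin n → ResidueField M)) (g : PRegular p T) :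
    ∃ ξ : Multiset AlgebraicIntegers, (∀ z ∈ ξ, z ^ orderOf g.1 = 1) ∧ ∀ i : ℕ,
      (ρ (g.1 ^ i)).charpoly =
        (ξ.map fun z => Polynomial.X - Polynomial.C (reduction M (z ^ i))).prod := by
  simp only [map_pow ρ]
  exact exists_eigenvalue_lifts hp g.2 (by rw [← map_pow, pow_orderOf_eq_one, map_one])

theorem sum_map_coe (ξ : Multiset AlgebraicIntegers) :
    (ξ.map fun z => (z : ℂ)).sum = (ξ.sum : AlgebraicIntegers) := by
  simp [Multiset.bind_def, Multiset.pure_def, Multiset.bind_singleton]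

theorem exists_isBrauerCharacter (hp : p.Prime)
    (ρ : Representation (ResidueField M) T (Fin n → ResidueField M)) :
    ∃ χ, IsBrauerCharacter p M ρ χ := by
  choose ξ hξ hchar using exists_eigenvalue_lifts_of_pRegular hp ρ
  refine ⟨fun g => (ξ g).sum, fun g =>
    ⟨ξ g, fun z hz => ⟨_, g.2, hξ g z hz⟩, ?_, (sum_map_coe _).symm⟩⟩
  simpa only [pow_one] using hchar g 1

theorem IsBrauerCharacter.apply_eq_sum (hp : p.Prime) (hχ : IsBrauerCharacter p M ρ χ)
    {g : PRegular p T} {ξ : Multiset AlgebraicIntegers}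
    (hξ : ∀ z ∈ ξ, ∃ m : ℕ, m.Coprime p ∧ z ^ m = 1)
    (hchar : (ρ g.1).charpoly =
      (ξ.map fun z => Polynomial.X - Polynomial.C (reduction M z)).prod) :
    χ g = (ξ.sum : AlgebraicIntegers) := by
  obtain ⟨η, hη, hηchar, hsum⟩ := hχ g
  have hroots (ζ : Multiset AlgebraicIntegers) :
      (ζ.map fun z => Polynomial.X - Polynomial.C (reduction M z)).prod.roots =
        ζ.map (reduction M) := by
    rw [← Polynomial.roots_multiset_prod_X_sub_C (ζ.map (reduction M)), Multiset.map_map]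
    rfl
  have hmap : η.map (reduction M) = ξ.map (reduction M) := by
    rw [← hroots, ← hroots, ← hηchar, hchar]
  rw [hsum, map_reduction_injOn hp hη hξ hmap, sum_map_coe]

theorem cyclicAverage_eq_sum_range [Finite T] (χ : PRegular p T → ℂ) (g : PRegular p T) :
    cyclicAverage χ g = 1 / (orderOf g.1 : ℂ) * ∑ i ∈ Finset.range (orderOf g.1),
      χ (g.ofMemZPowers ⟨g.1 ^ i, Subgroup.npow_mem_zpowers g.1 i⟩) := by
  rw [cyclicAverage, ← finsum_comp_equiv (finEquivZPowers (isOfFinOrder_of_finite g.1)),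
    finsum_eq_sum_of_fintype, ← Fin.sum_univ_eq_sum_range
      fun i => χ (g.ofMemZPowers ⟨g.1 ^ i, Subgroup.npow_mem_zpowers g.1 i⟩)]
  rfl

theorem cyclicAverage_eq_count [DecidableEq AlgebraicIntegers] [Finite T] (hp : p.Prime)
    (hχ : IsBrauerCharacter p M ρ χ) {g : PRegular p T} {ξ : Multiset AlgebraicIntegers}
    (hξ : ∀ z ∈ ξ, z ^ orderOf g.1 = 1)
    (hchar : ∀ i : ℕ, (ρ (g.1 ^ i)).charpoly =
      (ξ.map fun z => Polynomial.X - Polynomial.C (reduction M (z ^ i))).prod) :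
    cyclicAverage χ g = ξ.count 1 := by
  have hval (i : ℕ) : χ (g.ofMemZPowers ⟨g.1 ^ i, Subgroup.npow_mem_zpowers g.1 i⟩) =
      ((ξ.map (· ^ i)).sum : AlgebraicIntegers) := by
    refine hχ.apply_eq_sum hp (fun w hw => ?_) ?_
    · obtain ⟨z, hz, rfl⟩ := Multiset.mem_map.1 hw
      exact ⟨_, g.2, by rw [pow_right_comm, hξ z hz, one_pow]⟩
    · rw [Multiset.map_map]
      exact hchar i
  have hsum := congrArg (algebraMap AlgebraicIntegers ℂ) (sum_range_sum_map_pow hξ)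
  rw [map_sum, map_mul, map_natCast, map_natCast] at hsum
  have h0 : (orderOf g.1 : ℂ) ≠ 0 := Nat.cast_ne_zero.2 (orderOf_pos g.1).ne'
  rw [cyclicAverage_eq_sum_range, Finset.sum_congr rfl fun i _ => hval i]
  exact (congrArg _ hsum).trans (by rw [one_div, inv_mul_cancel_left₀ h0])

theorem cyclicAverage_pos_iff [Finite T] (hp : p.Prime) (hχ : IsBrauerCharacter p M ρ χ)
    (g : PRegular p T) : 0 < cyclicAverage χ g ↔ HasEigenvalue (ρ g.1) 1 := by
  classical
  obtain ⟨ξ, hξ, hchar⟩ := exists_eigenvalue_lifts_of_pRegular hp ρ g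
  have hchar1 := hchar 1
  simp only [pow_one] at hchar1
  rw [cyclicAverage_eq_count hp hχ hξ hchar, Nat.cast_pos, Multiset.count_pos,
    Module.End.hasEigenvalue_iff_isRoot_charpoly, hchar1, Polynomial.IsRoot.def,
    Polynomial.eval_multiset_prod, Multiset.prod_eq_zero_iff, Multiset.map_map, Multiset.mem_map]
  simp only [Function.comp_apply, Polynomial.eval_sub, Polynomial.eval_X, Polynomial.eval_C,
    sub_eq_zero]
  constructor
  · exact fun h => ⟨1, h, (map_one _).symm⟩
  · rintro ⟨z, hz, hz1⟩
    have : z = 1 := eq_one_of_map_eq_one_of_pow_eq_one (reduction M)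
      (natCast_ne_zero_of_coprime hp g.2) (hξ z hz) hz1.symm
    rwa [← this]

end BrauerCharacters

/-! ### Fixed points in extensions -/

theorem fixedPointFree_of_surjective {H K : Type*} [Group H] [Finite H] [Group K] {φ : H →* H}
    {ψ : K →* K} {π : H →* K} (hπ : Function.Surjective π) (hφψ : π.comp φ = ψ.comp π)
    (hφ : MonoidHom.FixedPointFree φ) : MonoidHom.FixedPointFree ψ := by
  have : Finite K := Finite.of_surjective π hπ
  -- On a finite group, fixed-point freeness of `ψ` means injectivity, hence surjectivity, of
  -- `x ↦ x / ψ x`, and surjectivity passes to quotients.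
  have hsurj : Function.Surjective (MonoidHom.commutatorMap ψ) := fun k => by
    obtain ⟨h, rfl⟩ := hπ k
    obtain ⟨g, rfl⟩ := hφ.commutatorMap_surjective h
    refine ⟨π g, ?_⟩
    simp only [MonoidHom.commutatorMap_apply, map_div]
    exact congrArg (π g / ·) (DFunLike.congr_fun hφψ g).symm
  intro k hk
  refine Finite.injective_iff_surjective.2 hsurj ?_
  simp only [MonoidHom.commutatorMap_apply, hk, div_self', map_one]

section FixedPoints

variable {G G' T : Type*} [Group G] [Group G'] [Group T]

/-- Some preimage of `t` under `f` centralizes a nontrivial element of `N`. For `N = f.ker`, this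
is the obstruction created by the extension `f`: it is how an element of order `p * q` of `G` can
arise from an element of order `q` of `T`. -/
def HasFixedPointIn (f : G →* T) (N : Subgroup G) (t : T) : Prop :=
  ∃ x, f x = t ∧ ∃ z ∈ N, z ≠ 1 ∧ Commute x z

theorem hasFixedPointIn_iff_not_fixedPointFree {f : G →* T} {N : Subgroup G} [N.Normal] {t : T} :
    HasFixedPointIn f N t ↔
      ∃ x, f x = t ∧ ¬ MonoidHom.FixedPointFree (MulAut.conjNormal (H := N) x) := by
  simp only [HasFixedPointIn, MonoidHom.FixedPointFree, Subtype.forall, not_forall, Subtype.ext_iff,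
    MulAut.conjNormal_apply, mul_inv_eq_iff_eq_mul, commute_iff_eq, OneMemClass.coe_one,
    exists_prop, ne_eq, and_comm]

theorem hasFixedPointIn_comap_iff [Finite G] {π : G →* G'} (hπ : Function.Surjective π)
    (f : G' →* T) (N : Subgroup G') [N.Normal] {t : T} :
    HasFixedPointIn (f.comp π) (N.comap π) t ↔
      HasFixedPointIn (f.comp π) π.ker t ∨ HasFixedPointIn f N t := by
  constructor
  · rintro ⟨x, hx, z, hzN, hz, hxz⟩
    by_cases hzπ : z ∈ π.ker
    · exact .inl ⟨x, hx, z, hzπ, hz, hxz⟩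
    · exact .inr ⟨π x, hx, π z, hzN, hzπ, hxz.map π⟩
  rintro (⟨x, hx, z, hzπ, hz, hxz⟩ | h)
  · exact ⟨x, hx, z, Subgroup.ker_le_comap π N hzπ, hz, hxz⟩
  · obtain ⟨x', hx', hfree⟩ := hasFixedPointIn_iff_not_fixedPointFree.1 h
    obtain ⟨x, rfl⟩ := hπ x'
    refine hasFixedPointIn_iff_not_fixedPointFree.2 ⟨x, hx', mt (fun hfree' => ?_) hfree⟩
    refine fixedPointFree_of_surjective (φ := (MulAut.conjNormal x).toMonoidHom)
      (ψ := (MulAut.conjNormal (π x)).toMonoidHom)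
      (π.subgroupComap_surjective_of_surjective N hπ) ?_ hfree'
    ext z
    change π (x * z * x⁻¹) = π x * π z * (π x)⁻¹
    simp only [map_mul, map_inv]

theorem exists_orderOf_eq_mul_pow [Finite G] {p : ℕ} {f : G →* T} (hp : p.Prime)
    (hf : IsPGroup p f.ker) (x : G) :
    ∃ k, orderOf x = orderOf (f x) * p ^ k ∧ (k ≠ 0 → HasFixedPointIn f f.ker (f x)) := by
  have : Fact p.Prime := ⟨hp⟩
  set o := orderOf (f x) with ho
  have hmem : x ^ o ∈ f.ker := by rw [MonoidHom.mem_ker, map_pow, ho, pow_orderOf_eq_one]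
  obtain ⟨k, hk⟩ := IsPGroup.iff_orderOf.1 hf ⟨x ^ o, hmem⟩
  rw [Subgroup.orderOf_mk] at hk
  have hdvd : o ∣ orderOf x := orderOf_map_dvd f x
  have ho0 : o ≠ 0 := ne_zero_of_dvd_ne_zero (orderOf_pos x).ne' hdvd
  refine ⟨k, by rw [← hk, orderOf_pow_of_dvd ho0 hdvd, Nat.mul_div_cancel' hdvd], fun hk0 => ?_⟩
  refine ⟨x, rfl, x ^ o, hmem, fun h1 => ?_, Commute.self_pow x o⟩
  rw [h1, orderOf_one] at hk
  exact (Nat.one_lt_pow hk0 hp.one_lt).ne hk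

theorem exists_orderOf_eq_of_dvd_orderOf [Finite G] {x : G} {n : ℕ} (h : n ∣ orderOf x) :
    ∃ k, orderOf (x ^ k) = n :=
  ⟨_, orderOf_pow_orderOf_div (orderOf_pos x).ne' h⟩

theorem HasFixedPointIn.exists_orderOf_eq_mul [Finite G] {p n : ℕ} (hp : p.Prime)
    (hn : n.Coprime p) {f : G →* T} {N : Subgroup G} (hN : IsPGroup p N) {t : T}
    (ht : orderOf t = n) (h : HasFixedPointIn f N t) : ∃ g : G, orderOf g = p * n := by
  have : Fact p.Prime := ⟨hp⟩
  obtain ⟨x, rfl, z, hzN, hz, hxz⟩ := h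
  obtain ⟨i, hi⟩ := exists_orderOf_eq_of_dvd_orderOf (ht ▸ orderOf_map_dvd f x)
  obtain ⟨k, hk⟩ := IsPGroup.iff_orderOf.1 hN ⟨z, hzN⟩
  rw [Subgroup.orderOf_mk] at hk
  have hk0 : k ≠ 0 := by
    rintro rfl
    exact hz (orderOf_eq_one_iff.1 hk)
  obtain ⟨j, hj⟩ := exists_orderOf_eq_of_dvd_orderOf (hk ▸ dvd_pow_self p hk0)
  refine ⟨z ^ j * x ^ i, ?_⟩
  rw [(hxz.symm.pow_pow j i).orderOf_mul_eq_mul_orderOf_of_coprime] <;> rw [hi, hj]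
  exact hn.symm

theorem exists_orderOf_eq_iff_of_coprime [Finite G] {p n : ℕ} (hp : p.Prime) (hn : n.Coprime p)
    {f : G →* T} (hf : Function.Surjective f) (hker : IsPGroup p f.ker) :
    (∃ g : G, orderOf g = n) ↔ ∃ t : T, orderOf t = n := by
  constructor
  · rintro ⟨x, rfl⟩
    obtain ⟨k, hk, -⟩ := exists_orderOf_eq_mul_pow hp hker x
    have hk0 : p ^ k = 1 :=
      Nat.Coprime.eq_one_of_dvd (hn.pow_right k).symm (Dvd.intro_left _ hk.symm)
    exact ⟨f x, by rw [hk, hk0, mul_one]⟩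
  · rintro ⟨t, rfl⟩
    obtain ⟨x, rfl⟩ := hf t
    obtain ⟨i, hi⟩ := exists_orderOf_eq_of_dvd_orderOf (orderOf_map_dvd f x)
    exact ⟨_, hi⟩

theorem exists_orderOf_eq_mul_iff_of_coprime [Finite G] {p n : ℕ} (hp : p.Prime)
    (hn : n.Coprime p) {f : G →* T} (hf : Function.Surjective f) (hker : IsPGroup p f.ker) :
    (∃ g : G, orderOf g = p * n) ↔
      (∃ t : T, orderOf t = p * n) ∨ ∃ t : T, orderOf t = n ∧ HasFixedPointIn f f.ker t := by
  constructor
  · rintro ⟨x, hx⟩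
    obtain ⟨k, hk, hfix⟩ := exists_orderOf_eq_mul_pow hp hker x
    obtain _ | k := k
    · exact .inl ⟨f x, by rw [← hx, hk, pow_zero, mul_one]⟩
    have hn' : orderOf (f x) * p ^ k = n := by
      refine Nat.eq_of_mul_eq_mul_left hp.pos ?_
      rw [← hx, hk, pow_succ', mul_left_comm]
    have hk1 : p ^ k = 1 :=
      Nat.Coprime.eq_one_of_dvd (hn.pow_right k).symm (Dvd.intro_left _ hn')
    exact .inr ⟨f x, by rw [← hn', hk1, mul_one], hfix k.succ_ne_zero⟩
  · rintro (⟨t, ht⟩ | ⟨t, ht, h⟩)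
    · obtain ⟨x, rfl⟩ := hf t
      obtain ⟨i, hi⟩ := exists_orderOf_eq_of_dvd_orderOf (ht ▸ orderOf_map_dvd f x)
      exact ⟨_, hi⟩
    · exact h.exists_orderOf_eq_mul hp hn hker ht

end FixedPoints

/-! ### Representations from extensions -/

section Extensions

/-- The subgroup `Ω₁(Z(N))` of the central elements of `N` with trivial `p`-th power, as a subgroup
of the ambient group, so that conjugation makes it a module over the quotient by `N`. -/
def omegaCenter {G : Type*} [Group G] (p : ℕ) (N : Subgroup G) : Subgroup G where
  carrier := {z | z ∈ N ∧ (∀ y ∈ N, Commute y z) ∧ z ^ p = 1}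
  one_mem' := ⟨N.one_mem, fun y _ => Commute.one_right y, one_pow p⟩
  mul_mem' := fun ⟨ha, ha', hap⟩ ⟨hb, hb', hbp⟩ =>
    ⟨N.mul_mem ha hb, fun y hy => (ha' y hy).mul_right (hb' y hy),
      by rw [(hb' _ ha).mul_pow, hap, hbp, one_mul]⟩
  inv_mem' := fun ⟨ha, ha', hap⟩ =>
    ⟨N.inv_mem ha, fun y hy => (ha' y hy).inv_right, by rw [inv_pow, hap, inv_one]⟩

variable {G T : Type*} [Group G] [Group T] {p : ℕ}

theorem omegaCenter_le (N : Subgroup G) : omegaCenter p N ≤ N := fun _ h => h.1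

instance omegaCenter_normal (N : Subgroup G) [hN : N.Normal] : (omegaCenter p N).Normal where
  conj_mem := by
    rintro z ⟨hz, hcomm, hzp⟩ g
    refine ⟨hN.conj_mem z hz g, fun y hy => ?_, by rw [conj_pow, hzp, mul_one, mul_inv_cancel]⟩
    have h := (Commute.conj_iff g).2 (hcomm (g⁻¹ * y * g) (by simpa using hN.conj_mem y hy g⁻¹))
    simpa [mul_assoc] using h

theorem omegaCenter_ne_bot [Finite G] (hp : p.Prime) {N : Subgroup G} (hN : IsPGroup p N)
    (hbot : N ≠ ⊥) : omegaCenter p N ≠ ⊥ := by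
  have : Fact p.Prime := ⟨hp⟩
  have : Nontrivial N := N.nontrivial_iff_ne_bot.2 hbot
  have : Nontrivial (Subgroup.center N) := hN.center_nontrivial
  obtain ⟨k, hk, hcard⟩ := (hN.to_subgroup (Subgroup.center N)).nontrivial_iff_card.1 this
  obtain ⟨z, hz⟩ := exists_prime_orderOf_dvd_card' (G := Subgroup.center N) p
    (hcard ▸ dvd_pow_self p hk.ne')
  have hzord : orderOf z.1.1 = p := by rw [Subgroup.orderOf_coe, Subgroup.orderOf_coe, hz]
  refine Subgroup.ne_bot_iff_exists_ne_one.2 ⟨⟨z.1.1, z.1.2, fun y hy => ?_, ?_⟩, fun h => ?_⟩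
  · exact congrArg Subtype.val (Subgroup.mem_center_iff.1 z.2 ⟨y, hy⟩)
  · rw [← hzord, pow_orderOf_eq_one]
  · rw [congrArg Subtype.val h, OneMemClass.coe_one, orderOf_one] at hzord
    exact hp.one_lt.ne hzord

instance (N : Subgroup G) : CommGroup (omegaCenter p N) :=
  { (inferInstance : Group (omegaCenter p N)) with
    mul_comm := fun a b => Subtype.ext (b.2.2.1 a.1 a.2.1) }

instance (N : Subgroup G) : Module (ZMod p) (Additive (omegaCenter p N)) :=
  AddCommGroup.zmodModule fun z => congrArg Additive.ofMul
    (Subtype.ext z.toMul.2.2.2 : z.toMul ^ p = 1)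

/-- An action of `T` by automorphisms of an elementary abelian `p`-group, as a representation over
the prime field. -/
def zmodRepresentation {N : Type*} [CommGroup N] [Module (ZMod p) (Additive N)]
    (φ : T →* MulAut N) : Representation (ZMod p) T (Additive N) where
  toFun t := AddMonoidHom.toZModLinearMap p (MonoidHom.toAdditive (φ t).toMonoidHom)
  map_one' := by
    ext z
    simp
  map_mul' s t := by
    ext z
    simp

theorem hasEigenvalue_zmodRepresentation_one_iff {N : Type*} [CommGroup N]
    [Module (ZMod p) (Additive N)] {φ : T →* MulAut N} {t : T} :
    HasEigenvalue (zmodRepresentation (p := p) φ t) 1 ↔ ∃ z ≠ 1, φ t z = z := by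
  rw [hasEigenvalue_iff_exists_ne_zero]
  simp only [one_smul]
  rfl

theorem exists_representation_omegaCenter {f : G →* T} (hf : Function.Surjective f) :
    ∃ σ : Representation (ZMod p) T (Additive (omegaCenter p f.ker)),
      ∀ t, HasEigenvalue (σ t) 1 ↔ HasFixedPointIn f (omegaCenter p f.ker) t := by
  have hker : f.ker ≤ (MulAut.conjNormal (H := omegaCenter p f.ker)).ker := fun y hy => by
    ext z
    rw [MulAut.conjNormal_apply, mul_inv_eq_iff_eq_mul]
    exact z.2.2.1 y hy
  let φ : T →* MulAut (omegaCenter p f.ker) := f.liftOfSurjective hf ⟨MulAut.conjNormal, hker⟩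
  have hφ (x : G) : φ (f x) = MulAut.conjNormal x := MonoidHom.liftOfRightInverse_comp_apply ..
  have hfix (x : G) (z : omegaCenter p f.ker) : φ (f x) z = z ↔ Commute x z := by
    rw [hφ, Subtype.ext_iff, MulAut.conjNormal_apply, mul_inv_eq_iff_eq_mul, commute_iff_eq]
  refine ⟨zmodRepresentation φ, fun t => hasEigenvalue_zmodRepresentation_one_iff.trans ⟨?_, ?_⟩⟩
  · rintro ⟨z, hz, hfz⟩
    obtain ⟨x, rfl⟩ := hf t
    exact ⟨x, rfl, z, z.2, fun h => hz (Subtype.ext h), (hfix x z).1 hfz⟩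
  · rintro ⟨x, rfl, z, hzmem, hz, hxz⟩
    exact ⟨⟨z, hzmem⟩, fun h => hz (congrArg Subtype.val h), (hfix x ⟨z, hzmem⟩).2 hxz⟩

theorem hasEigenvalue_prod_iff {R V W : Type*} [CommRing R] [AddCommGroup V] [Module R V]
    [AddCommGroup W] [Module R W] {σ : Representation R T V} {τ : Representation R T W} {t : T}
    {μ : R} : HasEigenvalue (σ.prod τ t) μ ↔ HasEigenvalue (σ t) μ ∨ HasEigenvalue (τ t) μ := by
  constructor
  · intro h
    obtain ⟨⟨v, w⟩, hne, hfix⟩ := hasEigenvalue_iff_exists_ne_zero.1 h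
    obtain ⟨hv, hw⟩ := Prod.ext_iff.1 hfix
    by_cases hv0 : v = 0
    · exact .inr (hasEigenvalue_iff_exists_ne_zero.2
        ⟨w, fun hw0 => hne (by rw [hv0, hw0]; rfl), hw⟩)
    · exact .inl (hasEigenvalue_iff_exists_ne_zero.2 ⟨v, hv0, hv⟩)
  · rintro (h | h)
    · refine hasEigenvalue_of_injective (LinearMap.inl R V W) LinearMap.inl_injective ?_ h
      ext <;> simp
    · refine hasEigenvalue_of_injective (LinearMap.inr R V W) LinearMap.inr_injective ?_ h
      ext <;> simp

theorem exists_representation_hasEigenvalue_one_iff.{u} {G : Type u} [Group G] [Finite G]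
    (hp : p.Prime) {f : G →* T} (hf : Function.Surjective f) (hker : IsPGroup p f.ker) :
    ∃ (V : Type u) (_ : AddCommGroup V) (_ : Module (ZMod p) V) (_ : Finite V)
      (σ : Representation (ZMod p) T V),
      ∀ t, HasEigenvalue (σ t) 1 ↔ HasFixedPointIn f f.ker t := by
  induction hn : Nat.card G using Nat.strong_induction_on generalizing G with | _ n ih
  by_cases hbot : f.ker = ⊥
  · refine ⟨PUnit, inferInstance, inferInstance, inferInstance, 1, fun t => ⟨fun h => ?_, ?_⟩⟩
    · obtain ⟨v, hv, -⟩ := hasEigenvalue_iff_exists_ne_zero.1 h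
      exact absurd (Subsingleton.elim v 0) hv
    · rintro ⟨x, -, z, hz, hz1, -⟩
      exact absurd (Subgroup.mem_bot.1 (hbot ▸ hz)) hz1
  let Z := omegaCenter p f.ker
  let π : G →* G ⧸ Z := QuotientGroup.mk' Z
  let f' : G ⧸ Z →* T := QuotientGroup.lift Z f (omegaCenter_le f.ker)
  have hπ : Function.Surjective π := QuotientGroup.mk'_surjective Z
  have hker' : f'.ker.comap π = f.ker := MonoidHom.comap_ker f' π
  have hf'ker : IsPGroup p f'.ker :=
    (hker.of_equiv (MulEquiv.subgroupCongr hker'.symm)).of_surjective (π.subgroupComap f'.ker)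
      (π.subgroupComap_surjective_of_surjective _ hπ)
  have hlt : Nat.card (G ⧸ Z) < n := by
    rw [← hn, Subgroup.card_eq_card_quotient_mul_card_subgroup Z]
    exact lt_mul_of_one_lt_right Nat.card_pos
      (Z.one_lt_card_iff_ne_bot.2 (omegaCenter_ne_bot hp hker hbot))
  obtain ⟨σ, hσ⟩ := exists_representation_omegaCenter (p := p) hf
  obtain ⟨V, _, _, _, σ', hσ'⟩ :=
    ih _ hlt (QuotientGroup.lift_surjective_of_surjective _ _ hf _) hf'ker rfl
  have : Finite (Additive Z) := inferInstanceAs (Finite Z)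
  refine ⟨Additive Z × V, inferInstance, inferInstance, inferInstance, σ.prod σ', fun t => ?_⟩
  have hsplit := hasFixedPointIn_comap_iff hπ f' f'.ker (t := t)
  rw [hker', QuotientGroup.ker_mk'] at hsplit
  exact (hasEigenvalue_prod_iff.trans (or_congr (hσ t) (hσ' t))).trans hsplit.symm

end Extensions

/-! ### Extensions from representations -/

section Realization

theorem hasEigenvalue_directSum_iff {R G ι : Type*} {V : ι → Type*} [CommRing R] [Monoid G]
    [∀ i, AddCommGroup (V i)] [∀ i, Module R (V i)] {ρ : ∀ i, Representation R G (V i)} {g : G}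
    {μ : R} : HasEigenvalue (Representation.directSum ρ g) μ ↔ ∃ i, HasEigenvalue (ρ i g) μ := by
  classical
  constructor
  · intro h
    obtain ⟨v, hv, hgv⟩ := hasEigenvalue_iff_exists_ne_zero.1 h
    obtain ⟨i, hi⟩ := DFunLike.ne_iff.1 hv
    exact ⟨i, hasEigenvalue_iff_exists_ne_zero.2 ⟨v i, hi, DFunLike.congr_fun hgv i⟩⟩
  · rintro ⟨i, h⟩
    refine hasEigenvalue_of_injective (DirectSum.lof R ι V i) (DirectSum.of_injective i) ?_ h
    ext v : 1
    simp

/-- The representation `ρ` over `S`, with its scalars restricted to `R`. -/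
def restrictScalarsRepresentation (R : Type*) {S G V : Type*} [CommSemiring R] [CommSemiring S]
    [Algebra R S] [Monoid G] [AddCommMonoid V] [Module R V] [Module S V] [IsScalarTower R S V]
    (ρ : Representation S G V) : Representation R G V where
  toFun g := (ρ g).restrictScalars R
  map_one' := by rw [map_one]; rfl
  map_mul' g h := by rw [map_mul]; rfl

theorem hasEigenvalue_restrictScalarsRepresentation_iff {R S G V : Type*} [CommRing R]
    [CommRing S] [Algebra R S] [Monoid G] [AddCommGroup V] [Module R V] [Module S V]
    [IsScalarTower R S V] {ρ : Representation S G V} {g : G} {μ : R} :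
    HasEigenvalue (restrictScalarsRepresentation R ρ g) μ ↔
      HasEigenvalue (ρ g) (algebraMap R S μ) := by
  simp only [hasEigenvalue_iff_exists_ne_zero, algebraMap_smul]
  rfl

theorem exists_finite_subrepresentation {k G V : Type*} [CommRing k] [Finite k] [Group G]
    [Finite G] [AddCommGroup V] [Module k V] (ρ : Representation k G V) {S : Set V}
    (hS : S.Finite) : ∃ W : Subrepresentation ρ, Finite W.toSubmodule ∧ S ⊆ W.toSubmodule := by
  let orbits : Set V := ⋃ g, ρ g '' S
  have horbits : orbits.Finite := Set.finite_iUnion fun g => hS.image (ρ g)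
  have hstable (g : G) ⦃v : V⦄ (hv : v ∈ Submodule.span k orbits) :
      ρ g v ∈ Submodule.span k orbits := by
    suffices Submodule.span k orbits ≤ (Submodule.span k orbits).comap (ρ g) from this hv
    refine Submodule.span_le.2 (Set.iUnion_subset fun h => ?_)
    rintro _ ⟨s, hs, rfl⟩
    refine Submodule.subset_span (Set.mem_iUnion.2 ⟨g * h, s, hs, ?_⟩)
    rw [map_mul, Module.End.mul_apply]
  refine ⟨⟨Submodule.span k orbits, hstable⟩, ?_, fun s hs => ?_⟩
  · have : Module.Finite k (Submodule.span k orbits) := .span_of_finite k horbits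
    exact Module.finite_of_finite k
  · exact Submodule.subset_span (Set.mem_iUnion.2 ⟨1, s, hs, by rw [map_one]; rfl⟩)

theorem exists_finite_subrepresentation_hasEigenvalue_iff {k G V : Type*} [CommRing k] [Finite k]
    [Group G] [Finite G] [AddCommGroup V] [Module k V] (ρ : Representation k G V) (μ : k) :
    ∃ W : Subrepresentation ρ, Finite W.toSubmodule ∧
      ∀ g, HasEigenvalue (W.toRepresentation g) μ ↔ HasEigenvalue (ρ g) μ := by
  have hvec (g : G) : ∃ v, HasEigenvalue (ρ g) μ → v ≠ 0 ∧ ρ g v = μ • v := by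
    by_cases h : HasEigenvalue (ρ g) μ
    · obtain ⟨v, hv⟩ := hasEigenvalue_iff_exists_ne_zero.1 h
      exact ⟨v, fun _ => hv⟩
    · exact ⟨0, fun h' => absurd h' h⟩
  choose v hv using hvec
  obtain ⟨W, hW, hvW⟩ := exists_finite_subrepresentation ρ (Set.finite_range v)
  refine ⟨W, hW, fun g => ⟨?_, fun h => ?_⟩⟩
  · exact hasEigenvalue_of_injective W.toSubmodule.subtype W.toSubmodule.subtype_injective rfl
  · obtain ⟨hv0, hgv⟩ := hv g h
    exact hasEigenvalue_iff_exists_ne_zero.2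
      ⟨⟨v g, hvW ⟨g, rfl⟩⟩, fun h0 => hv0 (congrArg Subtype.val h0), Subtype.ext hgv⟩

/-- The action of `G` by automorphisms of the additive group of a representation, written
multiplicatively so that it defines a semidirect product. -/
def mulAutOfRepresentation {k G V : Type*} [CommRing k] [Group G] [AddCommGroup V] [Module k V]
    (ρ : Representation k G V) : G →* MulAut (Multiplicative V) where
  toFun g := (LinearMap.GeneralLinearGroup.generalLinearEquiv k V
    (ρ.asGroupHom g)).toAddEquiv.toMultiplicative
  map_one' := by
    ext v
    simp
  map_mul' g h := by
    ext v
    simp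

theorem hasFixedPointIn_rightHom_iff {N T : Type*} [CommGroup N] [Group T] {φ : T →* MulAut N}
    {t : T} :
    HasFixedPointIn (SemidirectProduct.rightHom : N ⋊[φ] T →* T) SemidirectProduct.rightHom.ker t ↔
      ∃ n ≠ 1, φ t n = n := by
  constructor
  · rintro ⟨x, rfl, z, hz, hz1, hxz⟩
    rw [← SemidirectProduct.range_inl_eq_ker_rightHom] at hz
    obtain ⟨n, rfl⟩ := hz
    refine ⟨n, (map_ne_one_iff _ SemidirectProduct.inl_injective).1 hz1, ?_⟩
    have hleft := congrArg SemidirectProduct.left hxz.eq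
    simp only [SemidirectProduct.mul_left, SemidirectProduct.left_inl, SemidirectProduct.right_inl,
      map_one, MulAut.one_apply, mul_comm n] at hleft
    exact mul_left_cancel hleft
  · rintro ⟨n, hn, hfix⟩
    refine ⟨SemidirectProduct.inr t, rfl, SemidirectProduct.inl n, rfl,
      (map_ne_one_iff _ SemidirectProduct.inl_injective).2 hn, ?_⟩
    rw [commute_iff_eq, ← mul_inv_eq_iff_eq_mul, ← map_inv, ← SemidirectProduct.inl_aut, hfix]

theorem exists_extension_hasFixedPointIn_iff.{u} {T V : Type u} [Group T] [Finite T] {p : ℕ}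
    [NeZero p] [AddCommGroup V] [Module (ZMod p) V] (τ : Representation (ZMod p) T V) :
    ∃ (G : Type u) (_ : Group G) (_ : Finite G) (f : G →* T), Function.Surjective f ∧
      IsPGroup p f.ker ∧ ∀ t, HasFixedPointIn f f.ker t ↔ HasEigenvalue (τ t) 1 := by
  obtain ⟨W, _, hW⟩ := exists_finite_subrepresentation_hasEigenvalue_iff τ 1
  let φ := mulAutOfRepresentation W.toRepresentation
  have : Finite (Multiplicative W.toSubmodule) := inferInstanceAs (Finite W.toSubmodule)
  have hexp : IsPGroup p (Multiplicative W.toSubmodule) := fun w =>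
    ⟨1, by
      rw [pow_one]
      exact congrArg Multiplicative.ofAdd (ZModModule.char_nsmul_eq_zero p w.toAdd)⟩
  refine ⟨Multiplicative W.toSubmodule ⋊[φ] T, inferInstance,
    .of_equiv _ SemidirectProduct.equivProd.symm, SemidirectProduct.rightHom,
    SemidirectProduct.rightHom_surjective, ?_, fun t => ?_⟩
  · rw [← SemidirectProduct.range_inl_eq_ker_rightHom]
    exact hexp.of_surjective _ SemidirectProduct.inl.rangeRestrict_surjective
  · rw [hasFixedPointIn_rightHom_iff, ← hW, hasEigenvalue_iff_exists_ne_zero]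
    simp only [one_smul]
    rfl

end Realization

/-! ### Prime graph complements of extensions by `p`-groups -/

section PrimeGraphs

variable {G T : Type*} [Group G] [Group T] {p : ℕ} {f : G →* T}

/-- The edges `p - q`, with `q ≠ p` prime, that the prime graph complement of `T` loses in the
extension `f : G →* T`: some element of order `q` has a fixed point in the kernel. -/
def kernelFixedPointEdges (p : ℕ) (f : G →* T) : Set (Sym2 ℕ) :=
  {e | ∃ q : ℕ, q.Prime ∧ q ≠ p ∧ e = s(p, q) ∧ ∃ t, orderOf t = q ∧ HasFixedPointIn f f.ker t}

theorem mk_mem_kernelFixedPointEdges_iff {q : ℕ} (hq : q.Prime) (hqp : q ≠ p) :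
    s(p, q) ∈ kernelFixedPointEdges p f ↔ ∃ t, orderOf t = q ∧ HasFixedPointIn f f.ker t := by
  constructor
  · rintro ⟨r, -, -, hr, h⟩
    rwa [Sym2.congr_right.1 hr]
  · exact fun h => ⟨q, hq, hqp, rfl, h⟩

theorem iUnion_fixedPointEdges_eq (hp : p.Prime) {Y : Set (PRegular p T → ℂ)}
    (hY : ∀ g : PRegular p T, HasFixedPointIn f f.ker g.1 ↔ ∃ χ ∈ Y, 0 < cyclicAverage χ g) :
    ⋃ χ ∈ Y, fixedPointEdges p χ = kernelFixedPointEdges p f := by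
  ext e
  simp only [Set.mem_iUnion]
  constructor
  · rintro ⟨χ, hχ, q, hq, hqp, he, g, hg, hpos⟩
    exact ⟨q, hq, hqp, he, g.1, hg, (hY g).2 ⟨χ, hχ, hpos⟩⟩
  · rintro ⟨q, hq, hqp, he, t, rfl, hfix⟩
    let g : PRegular p T := ⟨t, (Nat.coprime_primes hq hp).2 hqp⟩
    obtain ⟨χ, hχ, hpos⟩ := (hY g).1 hfix
    exact ⟨χ, hχ, orderOf t, hq, hqp, he, g, rfl, hpos⟩

variable [Finite G] (hf : Function.Surjective f) (hker : IsPGroup p f.ker)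
include hf hker

theorem primeDivisors_eq_of_surjective (hp : p ∈ primeDivisors T) :
    primeDivisors G = primeDivisors T := by
  have : Fact p.Prime := ⟨hp.1⟩
  obtain ⟨k, hk⟩ := IsPGroup.iff_card.1 hker
  have hcard : Nat.card G = Nat.card T * p ^ k := by
    rw [← hk, Subgroup.card_eq_card_quotient_mul_card_subgroup f.ker,
      Nat.card_congr (QuotientGroup.quotientKerEquivOfSurjective f hf).toEquiv]
  ext r
  refine and_congr_right fun hr => ⟨fun h => ?_, fun h => hcard ▸ h.mul_right _⟩
  rw [hcard, hr.dvd_mul] at h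
  rcases h with h | h
  · exact h
  · rw [(Nat.prime_dvd_prime_iff_eq hr hp.1).1 (hr.dvd_of_dvd_pow h)]
    exact hp.2

theorem exists_orderOf_eq_mul_iff (hp : p.Prime) {a b : ℕ} (ha : a.Prime) (hb : b.Prime)
    (hab : a ≠ b) : (∃ g : G, orderOf g = a * b) ↔
      (∃ t : T, orderOf t = a * b) ∨ s(a, b) ∈ kernelFixedPointEdges p f := by
  have hleft {q : ℕ} (hq : q.Prime) (hqp : q ≠ p) : (∃ g : G, orderOf g = p * q) ↔
      (∃ t : T, orderOf t = p * q) ∨ s(p, q) ∈ kernelFixedPointEdges p f := by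
    rw [mk_mem_kernelFixedPointEdges_iff hq hqp]
    exact exists_orderOf_eq_mul_iff_of_coprime hp ((Nat.coprime_primes hq hp).2 hqp) hf hker
  obtain rfl | hap := eq_or_ne a p
  · exact hleft hb hab.symm
  obtain rfl | hbp := eq_or_ne b p
  · simpa only [mul_comm a b, Sym2.eq_swap] using hleft ha hab
  have hcop : (a * b).Coprime p :=
    ((Nat.coprime_primes ha hp).2 hap).mul_left ((Nat.coprime_primes hb hp).2 hbp)
  have hnot : s(a, b) ∉ kernelFixedPointEdges p f := by
    rintro ⟨q, -, -, h, -⟩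
    rcases Sym2.mem_iff.1 (h ▸ Sym2.mem_mk_left p q : p ∈ s(a, b)) with rfl | rfl
    · exact hap rfl
    · exact hbp rfl
  rw [exists_orderOf_eq_iff_of_coprime hp hcop hf hker, or_iff_left hnot]

theorem primeGraphComplement_eq_deleteEdges (hp : p ∈ primeDivisors T) :
    primeGraphComplement G =
      (primeGraphComplement T).deleteEdges (kernelFixedPointEdges p f) := by
  have hπ := primeDivisors_eq_of_surjective hf hker hp
  refine SimpleGraph.Subgraph.ext hπ ?_
  ext a b
  rw [SimpleGraph.Subgraph.deleteEdges_adj]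
  simp only [primeGraphComplement, complement, primeGraph, hπ]
  have horder (ha : a ∈ primeDivisors T) (hb : b ∈ primeDivisors T) (hab : a ≠ b) :=
    exists_orderOf_eq_mul_iff hf hker hp.1 ha.1 hb.1 hab
  tauto

end PrimeGraphs

section MainTheorem

universe u

variable {T : Type u} [Group T] {p : ℕ}

theorem isRealizableByPGroupExtension_iff {Λ : LabeledGraph} :
    IsRealizableByPGroupExtension p T Λ ↔
      ∃ (G : Type u) (_ : Group G) (_ : Finite G) (f : G →* T), Function.Surjective f ∧
        IsPGroup p f.ker ∧ Λ = primeGraphComplement G := by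
  constructor
  · rintro ⟨G, _, _, N, _, hN, ⟨e⟩, rfl⟩
    refine ⟨G, _, ‹_›, e.toMonoidHom.comp (QuotientGroup.mk' N),
      e.surjective.comp (QuotientGroup.mk'_surjective N), ?_, rfl⟩
    have hker : (e.toMonoidHom.comp (QuotientGroup.mk' N)).ker = N := by
      ext x
      simp
    rwa [hker]
  · rintro ⟨G, _, _, f, hf, hker, rfl⟩
    exact ⟨G, _, ‹_›, f.ker, inferInstance, hker,
      ⟨QuotientGroup.quotientKerEquivOfSurjective f hf⟩, rfl⟩

variable [Finite T] {M : Ideal AlgebraicIntegers} [M.IsMaximal] [CharP (ResidueField M) p]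

theorem exists_subset_iBr_hasFixedPointIn_iff (hp : p.Prime) {G : Type*} [Group G] [Finite G]
    {f : G →* T} (hf : Function.Surjective f) (hker : IsPGroup p f.ker) :
    ∃ Y ⊆ IBr p M T, ∀ g : PRegular p T,
      HasFixedPointIn f f.ker g.1 ↔ ∃ χ ∈ Y, 0 < cyclicAverage χ g := by
  have : Fact p.Prime := ⟨hp⟩
  let _ : Algebra (ZMod p) (ResidueField M) := ZMod.algebra _ p
  obtain ⟨V, _, _, _, σ, hσ⟩ := exists_representation_hasEigenvalue_one_iff hp hf hker
  refine ⟨{χ ∈ IBr p M T | ∀ g, 0 < cyclicAverage χ g → HasFixedPointIn f f.ker g.1},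
    Set.sep_subset _ _, fun g => ⟨fun hfix => ?_, fun ⟨χ, hχ, hpos⟩ => hχ.2 g hpos⟩⟩
  obtain ⟨n, ρ, hirr, hρg, hρ⟩ :=
    exists_isIrreducible_hasEigenvalue (ResidueField M) σ ((hσ g.1).2 hfix)
  rw [map_one] at hρg
  obtain ⟨χ, hχ⟩ := exists_isBrauerCharacter hp ρ
  refine ⟨χ, ⟨⟨n, ρ, hirr, hχ⟩, fun h hpos => ?_⟩, (cyclicAverage_pos_iff hp hχ g).2 hρg⟩
  refine (hσ h.1).1 (hρ h.1 1 ?_)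
  rw [map_one]
  exact (cyclicAverage_pos_iff hp hχ h).1 hpos

theorem exists_extension_hasFixedPointIn_iff_of_subset_iBr (hp : p.Prime)
    {Y : Set (PRegular p T → ℂ)} (hY : Y ⊆ IBr p M T) :
    ∃ (G : Type u) (_ : Group G) (_ : Finite G) (f : G →* T), Function.Surjective f ∧
      IsPGroup p f.ker ∧ ∀ g : PRegular p T,
        HasFixedPointIn f f.ker g.1 ↔ ∃ χ ∈ Y, 0 < cyclicAverage χ g := by
  have : NeZero p := ⟨hp.ne_zero⟩
  let _ : Algebra (ZMod p) (ResidueField M) := ZMod.algebra _ p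
  choose n ρ _ hρ using fun χ : Y => hY χ.2
  obtain ⟨G, _, hG, f, hf, hker, hfix⟩ := exists_extension_hasFixedPointIn_iff
    (Representation.directSum fun χ => restrictScalarsRepresentation (ZMod p) (ρ χ))
  refine ⟨G, _, hG, f, hf, hker, fun g => ?_⟩
  simp only [hfix, hasEigenvalue_directSum_iff, hasEigenvalue_restrictScalarsRepresentation_iff,
    map_one, ← cyclicAverage_pos_iff hp (hρ _) g, Subtype.exists, exists_prop]

end MainTheorem

end PrimeGraphExtension

end

theorem mainTheorem5_general (T : Type*) [Group T] [Finite T]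
    (p : ℕ) (hp : p ∈ primeDivisors T)
    (M : Ideal AlgebraicIntegers) [M.IsMaximal] (hM : (p : AlgebraicIntegers) ∈ M)
    (Λ : LabeledGraph) :
    IsRealizableByPGroupExtension p T Λ ↔
      ∃ Y : Set (PRegular p T → ℂ), Y ⊆ IBr p M T ∧
        Λ = (primeGraphComplement T).deleteEdges (⋃ χ ∈ Y, fixedPointEdges p χ) := by
  have : CharP (ResidueField M) p := charP_residueField hp.1 hM
  rw [isRealizableByPGroupExtension_iff]
  constructor
  · rintro ⟨G, _, _, f, hf, hker, rfl⟩
    obtain ⟨Y, hY, hfix⟩ := exists_subset_iBr_hasFixedPointIn_iff (M := M) hp.1 hf hker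
    refine ⟨Y, hY, ?_⟩
    rw [iUnion_fixedPointEdges_eq hp.1 hfix, primeGraphComplement_eq_deleteEdges hf hker hp]
  · rintro ⟨Y, hY, rfl⟩
    obtain ⟨G, _, hG, f, hf, hker, hfix⟩ :=
      exists_extension_hasFixedPointIn_iff_of_subset_iBr hp.1 hY
    refine ⟨G, _, hG, f, hf, hker, ?_⟩
    rw [iUnion_fixedPointEdges_eq hp.1 hfix, primeGraphComplement_eq_deleteEdges hf hker hp]

theorem mainTheorem5 (T : Type*) [Group T] [Finite T] [IsSimpleGroup T]
    (p : ℕ) (hp : p ∈ primeDivisors T)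
    (M : Ideal AlgebraicIntegers) [M.IsMaximal] (hM : (p : AlgebraicIntegers) ∈ M)
    (Λ : LabeledGraph) :
    IsRealizableByPGroupExtension p T Λ ↔
      ∃ Y : Set (PRegular p T → ℂ), Y ⊆ IBr p M T ∧
        Λ = (primeGraphComplement T).deleteEdges (⋃ χ ∈ Y, fixedPointEdges p χ) :=
  mainTheorem5_general T p hp M hM Λ
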